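/- Let $(H,d)$ be a CAT($-1$) space in which every geodesic segment extends to a bi-infinite geodesic, and let $\partial H$ be its geodesic boundary. For $p\in H$ let $(x\cdot y)_p=\frac12(d(x,p)+d(y,p)-d(x,y))$ be the Gromov product, extended to $\xi,\zeta\in\partial H$ by $(\xi\cdot\zeta)_p=\lim_{x\to\xi,\,y\to\zeta}(x\cdot y)_p\in[0,\infty]$, and put $\pi_p(\xi,\zeta)=e^{-(\xi\cdot\zeta)_p}$ (with $e^{-\infty}=0$). Let $SH$ be the set of bi-infinite unit speed geodesics $\gamma:\mathbb R\to H$, with endpoints $\gamma^{+},\gamma^{-}\in\partial H$, the metric $\operatorname{dist}(\gamma_1,\gamma_2)=\frac12\int_{-\infty}^{\infty}d(\gamma_1(t),\gamma_2(t))e^{-|t|}\,dt$ and the geodesic flow $(\mathsf g^s\gamma)(t)=\gamma(s+t)$. For $p,q\in H$ let $\Gamma_{p,q}$ be the set of $\gamma\in SH$ with $\gamma(0)=p$ and $\gamma(d(p,q))=q$. Assume that $H$ has bounded flip: there are constants $R_1,R_2>0$ such that for all $\zeta,\nu\in\partial H$ and $p\in H$ there are $\gamma_1,\gamma_2\in SH$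 with $\gamma_1^+=\zeta$, $\gamma_2^+=\nu$, $\gamma_1(0)=p=\gamma_2(0)$ and $$(\gamma_1^-\cdot\gamma_2^-)_p\ \ge\ R_1(\gamma_1^+\cdot\gamma_2^+)_p-R_2 .$$ Let $\Phi:SH\to\mathbb R$ be a bounded Hölder function (with some exponent $\beta\in(0,1]$, with respect to $\operatorname{dist}$) which is tempered: for all $p\ne q$ in $H$ and $\gamma_1,\gamma_2\in\Gamma_{p,q}$ one has $\Phi(\mathsf g^t\gamma_1)=\Phi(\mathsf g^t\gamma_2)$ for $0\le t\le d(p,q)$. Put $d^\Phi(p,q)=\int_0^{d(p,q)}\Phi(\mathsf g^t\gamma)\,dt$ for any $\gamma\in\Gamma_{p,q}$, with $d^\Phi(p,p)=0$. Then for all $p,q\in H$ and $\xi\in\partial H$ the limit $$\rho^\Phi_\xi(p,q)=\lim_{z\to\xi,\ z\in H}\bigl(d^\Phi(q,z)-d^\Phi(p,z)\bigr)$$ exists, and there are $\varepsilon>0$ and a constant $D_\Phi$, depending only on $H$ and $\Phi$, such that for all $p,q\in H$ $$\sup_{\zeta\neq\nu,\ \pi_p(\zeta,\nu)\le e^{-d(p,q)}}\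 \frac{|\rho^\Phi_\zeta(p,q)-\rho^\Phi_\nu(p,q)|}{\pi_p(\zeta,\nu)^{\varepsilon}}\ <\ D_\Phi\,e^{\varepsilon d(p,q)},$$ where the supremum over the empty set is $0$. -/

import Mathlib

open Filter Topology MeasureTheory
open scoped NNReal ENNReal

noncomputable section

namespace NegCurv

variable {H : Type*} [MetricSpace H]

/-- A metric space is CAT(-1) if any two points are joined by a geodesic segment and geodesic
triangles are at least as thin as their comparison triangles in the hyperbolic plane `UpperHalfPlane`
(of curvature -1). In a geodesic space, the points `a` with `dist x a + dist a y = dist x y`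
are exactly the points of the geodesic segments from `x` to `y`; any two distinct sides of a triangle
have a common vertex, called `x` below. -/
structure IsCATNegOne (H : Type*) [MetricSpace H] : Prop where
  exists_geodesic : ∀ x y : H, ∃ c : ℝ → H, c 0 = x ∧ c (dist x y) = y ∧
    ∀ s ∈ Set.Icc 0 (dist x y), ∀ t ∈ Set.Icc 0 (dist x y), dist (c s) (c t) = |s - t|
  comparison : ∀ x y z a b : H,
    dist x a + dist a y = dist x y → dist x b + dist b z = dist x z →
    ∀ x' y' z' a' b' : UpperHalfPlane,
      dist x' y' = dist x y → dist x' z' = dist x z → dist y' z' = dist y z →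
      dist x' a' = dist x a → dist a' y' = dist a y →
      dist x' b' = dist x b → dist b' z' = dist b z →
      dist a b ≤ dist a' b'

/-- Geodesic rays, parametrized by arc length. -/
def Ray (H : Type*) [MetricSpace H] : Type _ := {c : ℝ≥0 → H // Isometry c}

/-- Two rays are asymptotic if they stay at bounded distance from each other. -/
def asymptotic (H : Type*) [MetricSpace H] : Setoid (Ray H) where
  r c c' := ∃ C : ℝ, ∀ t, dist (c.1 t) (c'.1 t) ≤ C
  iseqv :=
    { refl := fun c => ⟨0, fun t => by simp⟩
      symm := fun ⟨C, h⟩ => ⟨C, fun t => by rw [dist_comm]; exact h t⟩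
      trans := fun ⟨C, h⟩ ⟨C', h'⟩ =>
        ⟨C + C', fun t => (dist_triangle _ _ _).trans (add_le_add (h t) (h' t))⟩ }

/-- The geodesic boundary `∂H`: asymptote classes of geodesic rays. -/
def Boundary (H : Type*) [MetricSpace H] : Type _ := Quotient (asymptotic H)

/-- The endpoint at infinity of a ray. -/
def Ray.endpoint (c : Ray H) : Boundary H := Quotient.mk (asymptotic H) c

/-- The trace on `H` of the neighbourhood filter of a boundary point `ξ` in the cone topology on
`H ∪ ∂H`. For a ray `c` ending at `ξ`, a basic neighbourhood consists of the `x` at distance more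
than `r` from `c 0` for which the point `y` of the segment from `c 0` to `x` at distance `r` from
`c 0` is `δ`-close to `c r`. -/
def nhdsBoundary (ξ : Boundary H) : Filter H :=
  ⨅ (c : Ray H) (_ : c.endpoint = ξ) (r : ℝ≥0) (δ : ℝ) (_ : 0 < δ),
    𝓟 {x : H | (r : ℝ) < dist (c.1 0) x ∧
      ∃ y : H, dist (c.1 0) y = r ∧ dist (c.1 0) y + dist y x = dist (c.1 0) x ∧
        dist y (c.1 r) < δ}

/-- The Gromov product `(x · y)_p` of points of `H`. -/
def gromovProd (p x y : H) : ℝ := (dist x p + dist y p - dist x y) / 2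

/-- The Gromov product `(ξ · ζ)_p` of boundary points: the limit of `(x · y)_p` as `x → ξ` and
`y → ζ`, with values in the extended reals (it is `⊤` for `ξ = ζ`). -/
def gromovProdBoundary (p : H) (ξ ζ : Boundary H) : EReal :=
  limUnder (nhdsBoundary ξ ×ˢ nhdsBoundary ζ)
    (fun z : H × H => ((gromovProd p z.1 z.2 : ℝ) : EReal))

/-- `π_p(ξ, ζ) = exp (-(ξ · ζ)_p)`, which is `0` for `ξ = ζ`. -/
def visualDist (p : H) (ξ ζ : Boundary H) : ℝ :=
  (EReal.exp (-gromovProdBoundary p ξ ζ)).toReal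

/-- The unit tangent space `SH`: bi-infinite geodesics, parametrized by arc length. -/
def UnitTangent (H : Type*) [MetricSpace H] : Type _ := {γ : ℝ → H // Isometry γ}

namespace UnitTangent

/-- The metric on `SH`. -/
def sdist (γ₁ γ₂ : UnitTangent H) : ℝ :=
  (1 / 2) * ∫ t : ℝ, dist (γ₁.1 t) (γ₂.1 t) * Real.exp (-|t|)

/-- The geodesic flow: `(flow s γ)(t) = γ(s + t)`. -/
def flow (s : ℝ) (γ : UnitTangent H) : UnitTangent H :=
  ⟨fun t => γ.1 (s + t), γ.2.comp (isometry_add_left s)⟩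

/-- The forward endpoint `γ⁺`. -/
def forward (γ : UnitTangent H) : Boundary H :=
  Ray.endpoint ⟨fun t => γ.1 t, γ.2.comp isometry_subtype_coe⟩

/-- The backward endpoint `γ⁻`. -/
def backward (γ : UnitTangent H) : Boundary H :=
  Ray.endpoint ⟨fun t => γ.1 (-t), γ.2.comp ((IsometryEquiv.neg ℝ).isometry.comp
    isometry_subtype_coe)⟩

/-- The set `Γ_{p,q}` of bi-infinite geodesics which are at `p` at time `0` and run through `q` at
time `d(p,q)`. -/
def through (p q : H) : Set (UnitTangent H) := {γ | γ.1 0 = p ∧ γ.1 (dist p q) = q}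

end UnitTangent

open UnitTangent

/-- Geodesic completeness: every geodesic segment extends to a bi-infinite geodesic. -/
def GeodesicallyComplete (H : Type*) [MetricSpace H] : Prop :=
  ∀ p q : H, p ≠ q → (through p q).Nonempty

/-- Bounded flip. -/
def BoundedFlip (H : Type*) [MetricSpace H] : Prop :=
  ∃ R₁ R₂ : ℝ, 0 < R₁ ∧ 0 < R₂ ∧ ∀ (ζ ν : Boundary H) (p : H),
    ∃ γ₁ γ₂ : UnitTangent H, γ₁.forward = ζ ∧ γ₂.forward = ν ∧ γ₁.1 0 = p ∧ γ₂.1 0 = p ∧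
      (R₁ : EReal) * gromovProdBoundary p γ₁.forward γ₂.forward - (R₂ : EReal)
        ≤ gromovProdBoundary p γ₁.backward γ₂.backward

/-- The class of bounded tempered Hölder functions on `SH`. -/
structure IsTemperedHolder (Φ : UnitTangent H → ℝ) : Prop where
  bounded : ∃ L : ℝ, ∀ γ, |Φ γ| ≤ L
  holder : ∃ K β : ℝ, 0 < β ∧ β ≤ 1 ∧ ∀ γ₁ γ₂, |Φ γ₁ - Φ γ₂| ≤ K * sdist γ₁ γ₂ ^ β
  tempered : ∀ p q : H, p ≠ q → ∀ γ₁ ∈ through p q, ∀ γ₂ ∈ through p q,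
    ∀ t ∈ Set.Icc 0 (dist p q), Φ (flow t γ₁) = Φ (flow t γ₂)

open Classical in
/-- `d^Φ(p,q)`, the integral of `Φ` along the segment from `p` to `q`. For tempered `Φ` it does not
depend on the geodesic chosen in `Γ_{p,q}`. -/
def phiDist (Φ : UnitTangent H → ℝ) (p q : H) : ℝ :=
  if h : (through p q).Nonempty then ∫ t in (0 : ℝ)..dist p q, Φ (flow t h.choose) else 0

/-- The `Φ`-Busemann function `ρ_ξ^Φ(p,q) = lim_{z → ξ} (d^Φ(q,z) - d^Φ(p,z))`. -/
def phiBusemann (Φ : UnitTangent H → ℝ) (ξ : Boundary H) (p q : H) : ℝ :=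
  limUnder (nhdsBoundary ξ) (fun z => phiDist Φ q z - phiDist Φ p z)

end NegCurv

end

/-!
The function `d^Φ` is additive along segments. For two segments `[o, x]` and `[o, y]`, bounded flip
extends them to geodesics that are close not only up to time `(x · y)_o` but also at negative times,
so that `dist` decays exponentially along the common part; by the Hölder condition the integrals of
`Φ` over the initial pieces of length `t ≤ (x · y)_o` differ by `O(exp (-ε ((x · y)_o - t)))`.
Cutting the four segments from `p` and `q` to `z` and `z'` at distance halfway between `d(p, q)`
and `(z · z')_p` from `p`, the tails towards `z` (towards `z'`) and the initial pieces at `p`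
(at `q`) almost cancel, and `d^Φ(q, z) - d^Φ(p, z)` and `d^Φ(q, z') - d^Φ(p, z')` differ by
`O(exp (-(ε / 2) ((z · z')_p - d(p, q))))`. As `z, z' → ξ` this tends to `0`, which gives the limit
by completeness; as `z → ζ` and `z' → ν` it becomes the Hölder bound.
-/

noncomputable section

namespace NegCurv

open Real UnitTangent

variable {H : Type*} [MetricSpace H]

/-! ### Triangles in the hyperbolic plane -/

theorem sinh_mul_cos_lt_cosh (r φ : ℝ) : sinh r * cos φ < cosh r :=
  calc sinh r * cos φ ≤ |sinh r| * |cos φ| := (le_abs_self _).trans_eq (abs_mul _ _)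
    _ ≤ |sinh r| := mul_le_of_le_one_right (abs_nonneg _) (abs_cos_le_one φ)
    _ = sinh |r| := abs_sinh r
    _ < cosh |r| := sinh_lt_cosh _
    _ = cosh r := cosh_abs r

/-- The point of the hyperbolic plane with polar coordinates `(r, φ)` around `i`, as a point of the
upper half plane. Comparison triangles are placed with one vertex at `i`. -/
def polarPoint (r φ : ℝ) : UpperHalfPlane :=
  ⟨⟨sinh r * sin φ / (cosh r - sinh r * cos φ), 1 / (cosh r - sinh r * cos φ)⟩,
    one_div_pos.2 (sub_pos.2 (sinh_mul_cos_lt_cosh r φ))⟩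

theorem sq_sinh_mul_sin_add_one (r φ : ℝ) : (sinh r * sin φ) ^ 2 + 1 =
    (cosh r - sinh r * cos φ) * (cosh r + sinh r * cos φ) := by
  linear_combination sinh r ^ 2 * sin_sq_add_cos_sq φ - cosh_sq r

theorem cosh_dist_polarPoint (r φ s ψ : ℝ) :
    cosh (dist (polarPoint r φ) (polarPoint s ψ)) =
      cosh r * cosh s - sinh r * sinh s * cos (φ - ψ) := by
  have hD : 0 < cosh r - sinh r * cos φ := sub_pos.2 (sinh_mul_cos_lt_cosh r φ)
  have hE : 0 < cosh s - sinh s * cos ψ := sub_pos.2 (sinh_mul_cos_lt_cosh s ψ)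
  have hr := sq_sinh_mul_sin_add_one r φ
  have hs := sq_sinh_mul_sin_add_one s ψ
  have hDE : (cosh r - sinh r * cos φ) * (cosh s + sinh s * cos ψ) +
      (cosh s - sinh s * cos ψ) * (cosh r + sinh r * cos φ) =
      2 * (cosh r * cosh s - sinh r * sinh s * (cos φ * cos ψ)) := by ring
  rw [UpperHalfPlane.cosh_dist', cos_sub]
  simp only [polarPoint, UpperHalfPlane.re, UpperHalfPlane.im]
  generalize cosh r - sinh r * cos φ = D at *
  generalize cosh s - sinh s * cos ψ = E at *
  field_simp
  linear_combination E ^ 2 * hr + D ^ 2 * hs + D * E * hDE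

theorem dist_polarPoint_same_angle (r s φ : ℝ) :
    dist (polarPoint r φ) (polarPoint s φ) = |r - s| := by
  refine cosh_injOn dist_nonneg (abs_nonneg (r - s)) ?_
  rw [cosh_dist_polarPoint, cosh_abs, cosh_sub, sub_self, cos_zero, mul_one]

theorem dist_polarPoint_zero {r : ℝ} (hr : 0 ≤ r) (φ ψ : ℝ) :
    dist (polarPoint 0 φ) (polarPoint r ψ) = r := by
  refine cosh_injOn dist_nonneg hr ?_
  rw [cosh_dist_polarPoint, cosh_zero, sinh_zero, one_mul, zero_mul, zero_mul, sub_zero]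

theorem exists_dist_polarPoint_eq {a b c : ℝ} (ha : 0 < a) (hb : 0 < b) (hab : |a - b| ≤ c)
    (hc : c ≤ a + b) : ∃ θ : ℝ, dist (polarPoint a 0) (polarPoint b θ) = c := by
  have hc0 : 0 ≤ c := (abs_nonneg _).trans hab
  have hs : 0 < sinh a * sinh b := mul_pos (sinh_pos_iff.2 ha) (sinh_pos_iff.2 hb)
  have hlower : cosh (a - b) ≤ cosh c := cosh_le_cosh.2 (by rwa [abs_of_nonneg hc0])
  have hupper : cosh c ≤ cosh (a + b) :=
    cosh_le_cosh.2 (by rwa [abs_of_nonneg hc0, abs_of_nonneg (add_pos ha hb).le])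
  rw [cosh_sub] at hlower
  rw [cosh_add] at hupper
  refine ⟨arccos ((cosh a * cosh b - cosh c) / (sinh a * sinh b)),
    cosh_injOn dist_nonneg hc0 ?_⟩
  rw [cosh_dist_polarPoint, zero_sub, cos_neg, cos_arccos, mul_div_cancel₀ _ hs.ne',
    sub_sub_cancel]
  · rw [le_div_iff₀ hs]
    linarith
  · rw [div_le_one hs]
    linarith

theorem sinh_sub_le {a T : ℝ} (hT : 0 ≤ T) : sinh (a - T) ≤ exp (-T) * sinh a := by
  have h : exp (T - a) ≥ exp (-T - a) := exp_le_exp.2 (by linarith)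
  calc sinh (a - T) = (exp (a - T) - exp (T - a)) / 2 := by rw [sinh_eq, neg_sub]
    _ ≤ (exp (a - T) - exp (-T - a)) / 2 := by linarith
    _ = exp (-T) * sinh a := by rw [sinh_eq, mul_div_assoc', mul_sub, ← exp_add, ← exp_add]; ring_nf

theorem one_add_sq_half_le_cosh (x : ℝ) : 1 + x ^ 2 / 2 ≤ cosh x := by
  have hsinh : (x / 2) ^ 2 ≤ sinh (x / 2) ^ 2 :=
    sq_le_sq.2 ((self_le_sinh_iff.2 (abs_nonneg _)).trans_eq (abs_sinh _).symm)
  have hcosh := cosh_two_mul (x / 2)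
  rw [mul_div_cancel₀ x two_ne_zero, cosh_sq] at hcosh
  linarith

theorem one_sub_cos_le {a b T φ ψ : ℝ} (ha : 0 < a) (hb : 0 < b) (hT : 0 ≤ T) (hTb : T ≤ b)
    (h : dist (polarPoint a φ) (polarPoint b ψ) = a - T + (b - T)) :
    1 - cos (φ - ψ) ≤ 2 * exp (-T) ^ 2 := by
  have hsa : 0 < sinh a := sinh_pos_iff.2 ha
  have hs : 0 < sinh a * sinh b := mul_pos hsa (sinh_pos_iff.2 hb)
  have hcos := cosh_dist_polarPoint a φ b ψ
  have hsub : cosh (a - b) = cosh (a - T - (b - T)) := by rw [sub_sub_sub_cancel_right]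
  rw [h, cosh_add] at hcos
  rw [cosh_sub, cosh_sub (a - T)] at hsub
  have hsinh : sinh (a - T) * sinh (b - T) ≤ exp (-T) * sinh a * (exp (-T) * sinh b) :=
    mul_le_mul (sinh_sub_le hT) (sinh_sub_le hT) (sinh_nonneg_iff.2 (sub_nonneg.2 hTb))
      (mul_pos (exp_pos _) hsa).le
  refine le_of_mul_le_mul_right ?_ hs
  calc (1 - cos (φ - ψ)) * (sinh a * sinh b) = 2 * (sinh (a - T) * sinh (b - T)) := by
        linear_combination -hcos - hsub
    _ ≤ 2 * (exp (-T) * sinh a * (exp (-T) * sinh b)) := by linarith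
    _ = 2 * exp (-T) ^ 2 * (sinh a * sinh b) := by ring

theorem dist_polarPoint_le_exp_of_one_sub_cos_le {t T φ ψ : ℝ} (ht : 0 ≤ t)
    (h : 1 - cos (φ - ψ) ≤ 2 * exp (-T) ^ 2) :
    dist (polarPoint t φ) (polarPoint t ψ) ≤ exp (t - T) := by
  have hsinh : sinh t ≤ exp t / 2 := by
    rw [sinh_eq]
    linarith [exp_pos (-t)]
  have hcosh := one_add_sq_half_le_cosh (dist (polarPoint t φ) (polarPoint t ψ))
  rw [cosh_dist_polarPoint] at hcosh
  refine le_of_sq_le_sq ?_ (exp_pos _).le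
  calc dist (polarPoint t φ) (polarPoint t ψ) ^ 2
      ≤ 2 * (sinh t ^ 2 * (1 - cos (φ - ψ))) := by linarith [cosh_sq t]
    _ ≤ 2 * ((exp t / 2) ^ 2 * (2 * exp (-T) ^ 2)) := by
        gcongr
        exact sub_nonneg.2 (cos_le_one _)
    _ = exp (t - T) ^ 2 := by
        rw [sub_eq_add_neg, exp_add]
        ring

/-! ### Gromov products and thin triangles -/

theorem dist_add_dist_eq_symm {x y m : H} (hm : dist x m + dist m y = dist x y) :
    dist y m + dist m x = dist y x := by
  rw [dist_comm y m, dist_comm m x, dist_comm y x, add_comm, hm]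

theorem gromovProd_comm (p x y : H) : gromovProd p x y = gromovProd p y x := by
  rw [gromovProd, gromovProd, dist_comm x y, add_comm (dist x p)]

theorem gromovProd_nonneg (p x y : H) : 0 ≤ gromovProd p x y :=
  div_nonneg (sub_nonneg.2 (dist_triangle_right x y p)) zero_le_two

theorem gromovProd_add_gromovProd (p x y : H) :
    gromovProd p x y + gromovProd x p y = dist p x := by
  simp only [gromovProd, dist_comm x p, dist_comm y p, dist_comm y x]
  ring

theorem gromovProd_le_left (p x y : H) : gromovProd p x y ≤ dist p x := by
  linarith [gromovProd_add_gromovProd p x y, gromovProd_nonneg x p y]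

theorem gromovProd_le_right (p x y : H) : gromovProd p x y ≤ dist p y :=
  gromovProd_comm p x y ▸ gromovProd_le_left p y x

theorem gromovProd_mono {o x y u v : H} (hu : dist o u + dist u x = dist o x)
    (hv : dist o v + dist v y = dist o y) : gromovProd o u v ≤ gromovProd o x y := by
  have h := dist_triangle4 x u v y
  simp only [gromovProd, dist_comm _ o, dist_comm x u] at *
  linarith

theorem gromovProd_le_add_dist (p q x y : H) :
    gromovProd p x y ≤ gromovProd q x y + dist p q := by
  have hx := dist_triangle x q p
  have hy := dist_triangle y q p
  rw [dist_comm q p] at hx hy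
  simp only [gromovProd]
  linarith

namespace IsCATNegOne

theorem exists_point (hCAT : IsCATNegOne H) (x y : H) {t : ℝ} (ht0 : 0 ≤ t) (ht : t ≤ dist x y) :
    ∃ m : H, dist x m = t ∧ dist x m + dist m y = dist x y := by
  obtain ⟨c, hc0, hc1, hc⟩ := hCAT.exists_geodesic x y
  have hxm : dist x (c t) = t := by
    rw [← hc0, hc 0 ⟨le_rfl, dist_nonneg⟩ t ⟨ht0, ht⟩, zero_sub, abs_neg, abs_of_nonneg ht0]
  have hmy : dist (c t) y = dist x y - t := by
    conv_lhs => rw [← hc1]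
    rw [hc t ⟨ht0, ht⟩ _ ⟨dist_nonneg, le_rfl⟩, abs_sub_comm, abs_of_nonneg (sub_nonneg.2 ht)]
  exact ⟨c t, hxm, by rw [hxm, hmy, add_sub_cancel]⟩

theorem dist_le_dist_polarPoint (hCAT : IsCATNegOne H) {o x y u v : H}
    (hu : dist o u + dist u x = dist o x) (hv : dist o v + dist v y = dist o y) {φ ψ : ℝ}
    (hxy : dist (polarPoint (dist o x) φ) (polarPoint (dist o y) ψ) = dist x y) :
    dist u v ≤ dist (polarPoint (dist o u) φ) (polarPoint (dist o v) ψ) := by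
  have hside : ∀ {w z : H} (θ : ℝ), dist o w + dist w z = dist o z →
      dist (polarPoint (dist o w) θ) (polarPoint (dist o z) θ) = dist w z := fun θ h => by
    rw [dist_polarPoint_same_angle, abs_sub_comm, ← h, add_sub_cancel_left,
      abs_of_nonneg dist_nonneg]
  exact hCAT.comparison o x y u v hu hv (polarPoint 0 0) _ _ _ _
    (dist_polarPoint_zero dist_nonneg _ _) (dist_polarPoint_zero dist_nonneg _ _) hxy
    (dist_polarPoint_zero dist_nonneg _ _) (hside φ hu)
    (dist_polarPoint_zero dist_nonneg _ _) (hside ψ hv)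

theorem eq_of_dist_eq (hCAT : IsCATNegOne H) {x y u v : H} (huv : dist x u = dist x v)
    (hu : dist x u + dist u y = dist x y) (hv : dist x v + dist v y = dist x y) : u = v := by
  have h := hCAT.dist_le_dist_polarPoint hu hv (φ := 0) (ψ := 0) (by simp only [dist_self])
  rwa [huv, dist_self, dist_le_zero] at h

theorem dist_le_exp (hCAT : IsCATNegOne H) {o x y u v : H} (huv : dist o u = dist o v)
    (hu : dist o u + dist u x = dist o x) (hv : dist o v + dist v y = dist o y) :
    dist u v ≤ exp (dist o u - gromovProd o x y) := by
  rcases (dist_nonneg (x := o) (y := u)).eq_or_lt with hou | hou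
  · rw [← dist_eq_zero.1 hou.symm, ← dist_eq_zero.1 (huv.symm.trans hou.symm), dist_self]
    exact (exp_pos _).le
  have hox : 0 < dist o x := by linarith [dist_nonneg (x := u) (y := x)]
  have hoy : 0 < dist o y := by linarith [dist_nonneg (x := v) (y := y)]
  obtain ⟨θ, hθ⟩ := exists_dist_polarPoint_eq hox hoy (c := dist x y)
    (by simpa only [dist_comm o] using abs_dist_sub_le x y o)
    (by simpa only [dist_comm o] using dist_triangle_right x y o)
  have hprod : dist (polarPoint (dist o x) 0) (polarPoint (dist o y) θ) =
      dist o x - gromovProd o x y + (dist o y - gromovProd o x y) := by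
    rw [hθ, gromovProd, dist_comm x o, dist_comm y o]
    ring
  have hcomp := hCAT.dist_le_dist_polarPoint hu hv hθ
  rw [← huv] at hcomp
  exact hcomp.trans (dist_polarPoint_le_exp_of_one_sub_cos_le hou.le
    (one_sub_cos_le hox hoy (gromovProd_nonneg o x y) (gromovProd_le_right o x y) hprod))

theorem gromovProd_le_exp (hCAT : IsCATNegOne H) {p q w m : H}
    (hm : dist p m + dist m w = dist p w) (hqm : gromovProd p q w ≤ dist p m) :
    gromovProd m q w ≤ exp (gromovProd p q w - dist p m) / 2 := by
  have hbase := gromovProd_add_gromovProd w p q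
  have hpw := gromovProd_add_gromovProd p w q
  rw [gromovProd_comm p w q] at hpw
  obtain ⟨n, hwn, hn⟩ := hCAT.exists_point w q (t := dist w m) dist_nonneg
    (by linarith [hbase, gromovProd_le_right w p q, dist_comm m w])
  have hmn : dist m n ≤ exp (dist w m - gromovProd w p q) :=
    hCAT.dist_le_exp hwn.symm (dist_add_dist_eq_symm hm) hn
  have hexp : dist w m - gromovProd w p q = gromovProd p q w - dist p m := by
    rw [dist_comm w m]
    linarith
  rw [hexp] at hmn
  have htri := dist_triangle_left q m n
  rw [gromovProd, dist_comm q w]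
  linarith [dist_comm n m]

theorem abs_dist_quadrilateral_le (hCAT : IsCATNegOne H) {p q z z' : H} {B : ℝ}
    (hz : gromovProd p q z ≤ B) (hz' : gromovProd p q z' ≤ B) (hB : B ≤ gromovProd p z z') :
    |(dist p z - dist q z) - (dist p z' - dist q z')| ≤
      2 * exp (-(gromovProd p z z' - B) / 2) := by
  set T := gromovProd p z z'
  set τ := (T + B) / 2 with hτ
  have hB0 : 0 ≤ B := (gromovProd_nonneg p q z).trans hz
  obtain ⟨m, hpm, hm⟩ := hCAT.exists_point p z (t := τ) (by linarith)
    (by linarith [gromovProd_le_left p z z'])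
  obtain ⟨m', hpm', hm'⟩ := hCAT.exists_point p z' (t := τ) (by linarith)
    (by linarith [gromovProd_le_right p z z'])
  have hmm' : dist m m' ≤ exp (-(T - B) / 2) :=
    (hCAT.dist_le_exp (hpm.trans hpm'.symm) hm hm').trans (exp_le_exp.2 (by linarith))
  have hexcess : ∀ {w n : H}, gromovProd p q w ≤ B → dist p n = τ →
      dist p n + dist n w = dist p w → gromovProd n q w ≤ exp (-(T - B) / 2) / 2 :=
    fun hw hpn hn => (hCAT.gromovProd_le_exp hn (by linarith)).trans
      (div_le_div_of_nonneg_right (exp_le_exp.2 (by linarith)) zero_le_two)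
  have hdiff : ∀ {w n : H}, dist p n = τ → dist p n + dist n w = dist p w →
      dist p w - dist q w = τ - dist q n + 2 * gromovProd n q w := fun {w n} hpn hn => by
    rw [gromovProd, ← hn, hpn, dist_comm n w]
    ring
  have hqmm' := abs_le.1 ((abs_dist_sub_le m m' q).trans hmm')
  rw [dist_comm m, dist_comm m'] at hqmm'
  rw [hdiff hpm hm, hdiff hpm' hm', abs_le]
  constructor <;> linarith [hexcess hz hpm hm, hexcess hz' hpm' hm', gromovProd_nonneg m q z,
    gromovProd_nonneg m' q z', hqmm'.1, hqmm'.2]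

end IsCATNegOne

/-! ### Rays and boundary points -/

theorem exists_tendsto_of_eventually_dist_le {ι X : Type*} [PseudoMetricSpace X] [CompleteSpace X]
    {l : Filter ι} [l.NeBot] {F : ι → X} {e : ι × ι → ℝ} (he : Tendsto e (l ×ˢ l) (𝓝 0))
    (hF : ∀ᶠ z in l ×ˢ l, dist (F z.1) (F z.2) ≤ e z) : ∃ a, Tendsto F l (𝓝 a) := by
  refine cauchy_map_iff_exists_tendsto.1 (cauchy_map_iff'.2 ?_)
  exact tendsto_uniformity_iff_dist_tendsto_zero.2
    (squeeze_zero' (Eventually.of_forall fun _ => dist_nonneg) hF he)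

namespace Ray

theorem dist_eq (c : Ray H) (s t : ℝ≥0) : dist (c.1 s) (c.1 t) = |(s : ℝ) - t| := by
  rw [c.2.dist_eq, NNReal.dist_eq]

theorem dist_zero (c : Ray H) (t : ℝ≥0) : dist (c.1 0) (c.1 t) = t := by
  rw [c.dist_eq, NNReal.coe_zero, zero_sub, abs_neg, NNReal.abs_eq]

theorem dist_add_dist_eq (c : Ray H) {s t : ℝ≥0} (hst : s ≤ t) :
    dist (c.1 0) (c.1 s) + dist (c.1 s) (c.1 t) = dist (c.1 0) (c.1 t) := by
  rw [c.dist_zero, c.dist_zero, c.dist_eq, abs_sub_comm,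
    abs_of_nonneg (sub_nonneg.2 (NNReal.coe_le_coe.2 hst)), add_sub_cancel]

theorem gromovProd_mono {c c' : Ray H} (h0 : c.1 0 = c'.1 0) {s t s' t' : ℝ≥0} (hst : s ≤ t)
    (hst' : s' ≤ t') :
    gromovProd (c.1 0) (c.1 s) (c'.1 s') ≤ gromovProd (c.1 0) (c.1 t) (c'.1 t') :=
  NegCurv.gromovProd_mono (c.dist_add_dist_eq hst) (h0 ▸ c'.dist_add_dist_eq hst')

theorem dist_le_exp (hCAT : IsCATNegOne H) {c c' : Ray H} (h0 : c.1 0 = c'.1 0) (s s' t : ℝ≥0) :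
    dist (c.1 t) (c'.1 t) ≤ exp (t - gromovProd (c.1 0) (c.1 s) (c'.1 s')) := by
  have hdist := hCAT.dist_le_exp (o := c.1 0) (by rw [c.dist_zero t, h0, c'.dist_zero t])
    (c.dist_add_dist_eq (le_max_right s t)) (h0 ▸ c'.dist_add_dist_eq (le_max_right s' t))
  rw [c.dist_zero] at hdist
  exact hdist.trans (exp_le_exp.2
    (sub_le_sub_left (gromovProd_mono h0 (le_max_left s t) (le_max_left s' t)) _))

theorem eq_of_endpoint_eq (hCAT : IsCATNegOne H) {c c' : Ray H} (h0 : c.1 0 = c'.1 0)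
    (h : c.endpoint = c'.endpoint) : c = c' := by
  obtain ⟨C, hC⟩ := Quotient.exact h
  refine Subtype.ext (funext fun s => dist_le_zero.1 ?_)
  have hdist (t : ℝ≥0) : dist (c.1 s) (c'.1 s) ≤ exp (s + C / 2 - t) := by
    refine (dist_le_exp hCAT h0 t t s).trans (exp_le_exp.2 ?_)
    rw [gromovProd, dist_comm _ (c.1 0), dist_comm _ (c.1 0), c.dist_zero, h0, c'.dist_zero]
    linarith [hC t]
  have hexp : Tendsto (fun t : ℝ≥0 => exp (s + C / 2 - t)) atTop (𝓝 0) :=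
    tendsto_exp_atBot.comp (tendsto_atBot_add_const_left _ _
      (tendsto_neg_atTop_atBot.comp (NNReal.tendsto_coe_atTop.2 tendsto_id)))
  exact ge_of_tendsto' hexp hdist

theorem tendsto_nhdsBoundary (hCAT : IsCATNegOne H) (c : Ray H) :
    Tendsto c.1 atTop (nhdsBoundary c.endpoint) := by
  simp only [nhdsBoundary, tendsto_iInf, tendsto_principal]
  intro c' hc' r δ hδ
  obtain ⟨C, hC⟩ := Quotient.exact hc'
  have hcoe : Tendsto (fun t : ℝ≥0 => (t : ℝ)) atTop atTop := NNReal.tendsto_coe_atTop.2 tendsto_id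
  have hexp : Tendsto (fun t : ℝ≥0 => exp (r + C - t)) atTop (𝓝 0) :=
    tendsto_exp_atBot.comp (tendsto_atBot_add_const_left _ _ (tendsto_neg_atTop_atBot.comp hcoe))
  filter_upwards [hcoe.eventually_gt_atTop (r + C), hexp.eventually_lt_const hδ,
    eventually_ge_atTop r] with t htC htδ hrt
  have hCt : dist (c.1 t) (c'.1 t) ≤ C := dist_comm (c.1 t) (c'.1 t) ▸ hC t
  have hfar : (t : ℝ) - C ≤ dist (c'.1 0) (c.1 t) := by
    linarith [dist_triangle (c'.1 0) (c.1 t) (c'.1 t), c'.dist_zero t]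
  obtain ⟨y, hyr, hy⟩ := hCAT.exists_point (c'.1 0) (c.1 t) r.coe_nonneg (by linarith)
  have hclose := hCAT.dist_le_exp (hyr.trans (c'.dist_zero r).symm) hy (c'.dist_add_dist_eq hrt)
  refine ⟨by linarith, y, hyr, hy, (hclose.trans (exp_le_exp.2 ?_)).trans_lt htδ⟩
  rw [hyr, gromovProd, dist_comm _ (c'.1 0), dist_comm _ (c'.1 0), c'.dist_zero]
  linarith

theorem eventually_nhdsBoundary (c : Ray H) (r : ℝ≥0) {δ : ℝ} (hδ : 0 < δ) :
    ∀ᶠ x in nhdsBoundary c.endpoint, ∃ y : H, dist (c.1 0) y = r ∧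
      dist (c.1 0) y + dist y x = dist (c.1 0) x ∧ dist y (c.1 r) < δ := by
  unfold nhdsBoundary
  exact mem_of_superset (mem_iInf_of_mem c <| mem_iInf_of_mem rfl <| mem_iInf_of_mem r <|
    mem_iInf_of_mem δ <| mem_iInf_of_mem hδ <| mem_principal_self _) fun _ hx => hx.2

end Ray

theorem nhdsBoundary_neBot (hCAT : IsCATNegOne H) (ξ : Boundary H) : (nhdsBoundary ξ).NeBot := by
  obtain ⟨c, rfl⟩ := Quotient.exists_rep ξ
  exact (c.tendsto_nhdsBoundary hCAT).neBot

theorem tendsto_gromovProd_self (p : H) (ξ : Boundary H) :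
    Tendsto (fun z : H × H => gromovProd p z.1 z.2) (nhdsBoundary ξ ×ˢ nhdsBoundary ξ) atTop := by
  obtain ⟨c, rfl⟩ := Quotient.exists_rep ξ
  refine tendsto_atTop.2 fun M => ?_
  set r := (M + dist (c.1 0) p + 1).toNNReal
  have hnear := c.eventually_nhdsBoundary r one_half_pos
  filter_upwards [hnear.prod_mk hnear] with z
  rintro ⟨⟨y, hyr, hy, hyc⟩, y', hyr', hy', hyc'⟩
  have hyy' := dist_triangle_right y y' (c.1 r)
  have hprod : r - 1 / 2 ≤ gromovProd (c.1 0) y y' := by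
    rw [gromovProd, dist_comm y, dist_comm y', hyr, hyr']
    linarith
  linarith [gromovProd_mono hy hy', gromovProd_le_add_dist (c.1 0) p z.1 z.2,
    le_coe_toNNReal (M + dist (c.1 0) p + 1)]

theorem visualDist_eq (hCAT : IsCATNegOne H) {p : H} {ζ ν : Boundary H} {T : ℝ}
    (hT : Tendsto (fun z : H × H => gromovProd p z.1 z.2) (nhdsBoundary ζ ×ˢ nhdsBoundary ν)
      (𝓝 T)) : visualDist p ζ ν = exp (-T) := by
  have := nhdsBoundary_neBot hCAT ζ
  have := nhdsBoundary_neBot hCAT ν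
  have hprod : gromovProdBoundary p ζ ν = (T : EReal) :=
    ((continuous_coe_real_ereal.tendsto T).comp hT).limUnder_eq
  rw [visualDist, hprod, ← EReal.coe_neg, EReal.exp_coe, ENNReal.toReal_ofReal (exp_pos _).le]

theorem IsCATNegOne.abs_gromovProd_sub_le (hCAT : IsCATNegOne H) {p z w u : H} {B : ℝ}
    (hzu : gromovProd p z u ≤ B) (hwu : gromovProd p w u ≤ B) (hB : B ≤ gromovProd p z w) :
    |gromovProd p z u - gromovProd p w u| ≤ exp (-(gromovProd p z w - B) / 2) := by
  rw [gromovProd_comm p _ u] at hzu hwu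
  have hdiff : gromovProd p z u - gromovProd p w u =
      ((dist p z - dist u z) - (dist p w - dist u w)) / 2 := by
    simp only [gromovProd, dist_comm z p, dist_comm w p, dist_comm z u, dist_comm w u]
    ring
  rw [hdiff, abs_div, abs_two]
  linarith [hCAT.abs_dist_quadrilateral_le hzu hwu hB]

namespace Ray

theorem exists_eventually_gromovProd_le (hCAT : IsCATNegOne H) {c c' : Ray H}
    (h0 : c.1 0 = c'.1 0) (hne : c.endpoint ≠ c'.endpoint) :
    ∃ B : ℝ, ∀ᶠ z in nhdsBoundary c.endpoint ×ˢ nhdsBoundary c'.endpoint,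
      gromovProd (c.1 0) z.1 z.2 ≤ B := by
  obtain ⟨t, ht⟩ : ∃ t : ℝ≥0, 2 < dist (c.1 t) (c'.1 t) := by
    by_contra! hcon
    exact hne (Quotient.sound ⟨2, hcon⟩)
  refine ⟨t, ?_⟩
  filter_upwards [(c.eventually_nhdsBoundary t one_half_pos).prod_mk
    (c'.eventually_nhdsBoundary t one_half_pos)] with z
  rw [← h0]
  rintro ⟨⟨y, hyt, hy, hyc⟩, y', hyt', hy', hyc'⟩
  by_contra! hlt
  have hyy' : dist y y' ≤ 1 := (hCAT.dist_le_exp (hyt.trans hyt'.symm) hy hy').trans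
    (exp_le_one_iff.2 (by rw [hyt]; linarith))
  linarith [dist_triangle4 (c.1 t) y y' (c'.1 t), dist_comm (c.1 t) y]

theorem exists_tendsto_gromovProd (hCAT : IsCATNegOne H) {c c' : Ray H} (h0 : c.1 0 = c'.1 0)
    (hne : c.endpoint ≠ c'.endpoint) :
    ∃ T : ℝ, Tendsto (fun z : H × H => gromovProd (c.1 0) z.1 z.2)
      (nhdsBoundary c.endpoint ×ˢ nhdsBoundary c'.endpoint) (𝓝 T) := by
  obtain ⟨B, hB⟩ := exists_eventually_gromovProd_le hCAT h0 hne
  have := nhdsBoundary_neBot hCAT c.endpoint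
  have := nhdsBoundary_neBot hCAT c'.endpoint
  set p := c.1 0
  set l := nhdsBoundary c.endpoint
  set l' := nhdsBoundary c'.endpoint
  have hfst : Tendsto (fun z : (H × H) × H × H => gromovProd p z.1.1 z.2.1)
      ((l ×ˢ l') ×ˢ l ×ˢ l') atTop := (tendsto_gromovProd_self p c.endpoint).comp
    ((tendsto_fst.comp tendsto_fst).prodMk (tendsto_fst.comp tendsto_snd))
  have hsnd : Tendsto (fun z : (H × H) × H × H => gromovProd p z.1.2 z.2.2)
      ((l ×ˢ l') ×ˢ l ×ˢ l') atTop := (tendsto_gromovProd_self p c'.endpoint).comp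
    ((tendsto_snd.comp tendsto_fst).prodMk (tendsto_snd.comp tendsto_snd))
  have hmixed : ∀ᶠ z in (l ×ˢ l') ×ˢ l ×ˢ l', gromovProd p z.2.1 z.1.2 ≤ B :=
    ((tendsto_fst.comp tendsto_snd).prodMk (tendsto_snd.comp tendsto_fst)).eventually hB
  have hexp : Tendsto (fun T : ℝ => exp (-(T - B) / 2)) atTop (𝓝 0) :=
    tendsto_exp_atBot.comp ((tendsto_neg_atTop_atBot.comp
      (tendsto_atTop_add_const_right _ (-B) tendsto_id)).atBot_div_const two_pos)
  have herr := (hexp.comp hfst).add (hexp.comp hsnd)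
  rw [add_zero] at herr
  refine exists_tendsto_of_eventually_dist_le herr ?_
  filter_upwards [tendsto_fst.eventually hB, tendsto_snd.eventually hB, hmixed,
    hfst.eventually_ge_atTop B, hsnd.eventually_ge_atTop B] with z hz hw hwz hzw hzw'
  have hleft := hCAT.abs_gromovProd_sub_le hz hwz hzw
  rw [gromovProd_comm] at hwz hw
  have hright := hCAT.abs_gromovProd_sub_le hwz hw hzw'
  rw [gromovProd_comm p _ z.2.1, gromovProd_comm p _ z.2.1] at hright
  exact (abs_sub_le _ _ _).trans (add_le_add hleft hright)

theorem tendsto_gromovProdBoundary (hCAT : IsCATNegOne H) {c c' : Ray H} (h0 : c.1 0 = c'.1 0) :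
    Tendsto (fun z : H × H => ((gromovProd (c.1 0) z.1 z.2 : ℝ) : EReal))
      (nhdsBoundary c.endpoint ×ˢ nhdsBoundary c'.endpoint)
      (𝓝 (gromovProdBoundary (c.1 0) c.endpoint c'.endpoint)) := by
  refine tendsto_nhds_limUnder ?_
  by_cases h : c.endpoint = c'.endpoint
  · exact ⟨⊤, h ▸ EReal.tendsto_coe_atTop.comp (tendsto_gromovProd_self (c.1 0) c.endpoint)⟩
  · obtain ⟨T, hT⟩ := exists_tendsto_gromovProd hCAT h0 h
    exact ⟨T, (continuous_coe_real_ereal.tendsto T).comp hT⟩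

theorem tendsto_gromovProd (hCAT : IsCATNegOne H) {c c' : Ray H} (h0 : c.1 0 = c'.1 0) :
    Tendsto (fun t : ℝ≥0 => ((gromovProd (c.1 0) (c.1 t) (c'.1 t) : ℝ) : EReal)) atTop
      (𝓝 (gromovProdBoundary (c.1 0) c.endpoint c'.endpoint)) :=
  Tendsto.comp (f := fun t => (c.1 t, c'.1 t)) (tendsto_gromovProdBoundary hCAT h0)
    ((c.tendsto_nhdsBoundary hCAT).prodMk (c'.tendsto_nhdsBoundary hCAT))

theorem gromovProd_le_gromovProdBoundary (hCAT : IsCATNegOne H) {c c' : Ray H}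
    (h0 : c.1 0 = c'.1 0) (s s' : ℝ≥0) :
    ((gromovProd (c.1 0) (c.1 s) (c'.1 s') : ℝ) : EReal) ≤
      gromovProdBoundary (c.1 0) c.endpoint c'.endpoint := by
  refine ge_of_tendsto (tendsto_gromovProd hCAT h0) ?_
  filter_upwards [eventually_ge_atTop s, eventually_ge_atTop s'] with t ht ht'
  exact EReal.coe_le_coe_iff.2 (gromovProd_mono h0 ht ht')

theorem dist_le_exp_of_le_gromovProdBoundary (hCAT : IsCATNegOne H) {c c' : Ray H}
    (h0 : c.1 0 = c'.1 0) {G : ℝ}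
    (hG : (G : EReal) ≤ gromovProdBoundary (c.1 0) c.endpoint c'.endpoint) (t : ℝ≥0) :
    dist (c.1 t) (c'.1 t) ≤ exp (t - G) := by
  have hdist : ∀ G' < G, dist (c.1 t) (c'.1 t) ≤ exp (t - G') := fun G' hG' => by
    obtain ⟨s, hs⟩ := ((tendsto_gromovProd hCAT h0).eventually_const_lt
      ((EReal.coe_lt_coe_iff.2 hG').trans_le hG)).exists
    exact (dist_le_exp hCAT h0 s s t).trans
      (exp_le_exp.2 (sub_le_sub_left (EReal.coe_lt_coe_iff.1 hs).le _))
  have hlim : Tendsto (fun G' : ℝ => exp (t - G')) (𝓝[<] G) (𝓝 (exp (t - G))) :=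
    (Continuous.tendsto (by fun_prop) G).mono_left nhdsWithin_le_nhds
  exact ge_of_tendsto hlim (eventually_nhdsWithin_of_forall hdist)

theorem dist_le_four_mul_exp_half (hCAT : IsCATNegOne H) {c c' : Ray H} (h0 : c.1 0 = c'.1 0)
    {G : ℝ} (hG : (G : EReal) ≤ gromovProdBoundary (c.1 0) c.endpoint c'.endpoint) (t : ℝ≥0) :
    dist (c.1 t) (c'.1 t) ≤ 4 * exp ((t - G) / 2) := by
  have hexp := dist_le_exp_of_le_gromovProdBoundary hCAT h0 hG
  rcases le_total (t : ℝ) G with ht | ht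
  · linarith [hexp t, exp_le_exp.2 (by linarith : t - G ≤ (t - G) / 2), exp_pos ((t - G) / 2)]
  have hstart : dist (c.1 G.toNNReal) (c'.1 G.toNNReal) ≤ 1 := by
    rcases le_total G 0 with h | h
    · rw [toNNReal_of_nonpos h, h0, dist_self]
      exact zero_le_one
    · exact (hexp _).trans (exp_le_one_iff.2 (by rw [coe_toNNReal G h, sub_self]))
  have hGt : (G.toNNReal : ℝ) ≤ t := NNReal.coe_le_coe.2 (toNNReal_le_iff_le_coe.2 ht)
  have htri := dist_triangle4 (c.1 t) (c.1 G.toNNReal) (c'.1 G.toNNReal) (c'.1 t)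
  rw [c.dist_eq, c'.dist_eq, abs_of_nonneg (sub_nonneg.2 hGt), abs_sub_comm,
    abs_of_nonneg (sub_nonneg.2 hGt)] at htri
  linarith [add_one_le_exp ((t - G) / 2), le_coe_toNNReal G]

end Ray

/-! ### The unit tangent space and the integrals of tempered Hölder functions -/

theorem integral_exp_neg_abs_div_two : ∫ s : ℝ, exp (-|s| / 2) = 4 :=
  calc ∫ s : ℝ, exp (-|s| / 2) = ∫ s : ℝ, exp (-(1 / 2) * |s|) := by congr! 3; ring
    _ = 2 * ∫ s in Set.Ioi 0, exp (-(1 / 2) * s) := integral_comp_abs (f := fun s => exp _)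
    _ = 4 := by
      rw [integral_exp_mul_Ioi (by norm_num)]
      norm_num

theorem integrable_exp_neg_abs_div_two : Integrable fun s : ℝ => exp (-|s| / 2) := by
  by_contra h
  exact four_ne_zero (integral_exp_neg_abs_div_two.symm.trans (integral_undef h))

namespace UnitTangent

theorem dist_eq (γ : UnitTangent H) (s t : ℝ) : dist (γ.1 s) (γ.1 t) = |s - t| := by
  rw [γ.2.dist_eq, Real.dist_eq]

theorem sdist_nonneg (γ₁ γ₂ : UnitTangent H) : 0 ≤ sdist γ₁ γ₂ :=
  mul_nonneg (by norm_num) (integral_nonneg fun _ => mul_nonneg dist_nonneg (exp_pos _).le)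

theorem sdist_le {γ₁ γ₂ : UnitTangent H} {A : ℝ}
    (h : ∀ s, dist (γ₁.1 s) (γ₂.1 s) ≤ A * exp (|s| / 2)) : sdist γ₁ γ₂ ≤ 2 * A := by
  have hint : ∫ s : ℝ, dist (γ₁.1 s) (γ₂.1 s) * exp (-|s|) ≤ ∫ s : ℝ, A * exp (-|s| / 2) := by
    refine integral_mono_of_nonneg (ae_of_all _ fun _ => mul_nonneg dist_nonneg (exp_pos _).le)
      (integrable_exp_neg_abs_div_two.const_mul A) (ae_of_all _ fun s => ?_)
    calc dist (γ₁.1 s) (γ₂.1 s) * exp (-|s|) ≤ A * exp (|s| / 2) * exp (-|s|) :=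
          mul_le_mul_of_nonneg_right (h s) (exp_pos _).le
      _ = A * exp (-|s| / 2) := by
          rw [mul_assoc, ← exp_add]
          ring_nf
  rw [integral_const_mul, integral_exp_neg_abs_div_two] at hint
  rw [sdist]
  linarith

theorem sdist_flow_flow_le (γ : UnitTangent H) (s t : ℝ) :
    sdist (flow s γ) (flow t γ) ≤ 2 * |s - t| :=
  sdist_le fun u => calc
    dist (γ.1 (s + u)) (γ.1 (t + u)) = |s - t| := by rw [dist_eq, add_sub_add_right_eq_sub]
    _ ≤ |s - t| * exp (|u| / 2) :=
      le_mul_of_one_le_right (abs_nonneg _) (one_le_exp (by positivity))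

theorem flow_flow (s t : ℝ) (γ : UnitTangent H) : flow s (flow t γ) = flow (t + s) γ :=
  Subtype.ext (funext fun u => congrArg γ.1 (add_assoc t s u).symm)

/-- The geodesic `t ↦ γ (-t)`, that is `γ` run through backwards. It exchanges `γ⁺` and `γ⁻`. -/
def reverse (γ : UnitTangent H) : UnitTangent H :=
  ⟨fun t => γ.1 (-t), γ.2.comp (IsometryEquiv.neg ℝ).isometry⟩

theorem flow_reverse (s : ℝ) (γ : UnitTangent H) : flow s (reverse γ) = reverse (flow (-s) γ) :=
  Subtype.ext (funext fun t => congrArg γ.1 (neg_add s t))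

theorem sdist_reverse (γ₁ γ₂ : UnitTangent H) :
    sdist (reverse γ₁) (reverse γ₂) = sdist γ₁ γ₂ := by
  rw [sdist, sdist, ← integral_neg_eq_self]
  simp only [reverse, neg_neg, abs_neg]

theorem reverse_flow_mem_through {p q : H} {γ : UnitTangent H} (hγ : γ ∈ through p q) :
    reverse (flow (dist p q) γ) ∈ through q p := by
  constructor
  · change γ.1 (dist p q + -0) = q
    rw [neg_zero, add_zero, hγ.2]
  · change γ.1 (dist p q + -dist q p) = p
    rw [dist_comm q p, add_neg_cancel, hγ.1]

theorem flow_reverse_flow (s t : ℝ) (γ : UnitTangent H) :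
    flow t (reverse (flow s γ)) = reverse (flow (s - t) γ) := by
  rw [flow_reverse, flow_flow, sub_eq_add_neg]

theorem apply_dist_eq (hCAT : IsCATNegOne H) {p q m : H} {γ : UnitTangent H}
    (hγ : γ ∈ through p q) (hm : dist p m + dist m q = dist p q) : γ.1 (dist p m) = m := by
  have hstart : dist p (γ.1 (dist p m)) = dist p m := by
    rw [← hγ.1, dist_eq, zero_sub, abs_neg, abs_of_nonneg dist_nonneg]
  have hend : dist (γ.1 (dist p m)) q = dist m q := by
    conv_lhs => rw [← hγ.2]
    rw [dist_eq, abs_sub_comm, ← hm, add_sub_cancel_left, abs_of_nonneg dist_nonneg]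
  exact hCAT.eq_of_dist_eq hstart (by rw [hstart, hend, hm]) hm

theorem mem_through_left (hCAT : IsCATNegOne H) {p q m : H} {γ : UnitTangent H}
    (hγ : γ ∈ through p q) (hm : dist p m + dist m q = dist p q) : γ ∈ through p m :=
  ⟨hγ.1, apply_dist_eq hCAT hγ hm⟩

theorem flow_mem_through_right (hCAT : IsCATNegOne H) {p q m : H} {γ : UnitTangent H}
    (hγ : γ ∈ through p q) (hm : dist p m + dist m q = dist p q) :
    flow (dist p m) γ ∈ through m q := by
  constructor
  · change γ.1 (dist p m + 0) = m
    rw [add_zero, apply_dist_eq hCAT hγ hm]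
  · change γ.1 (dist p m + dist m q) = q
    rw [hm, hγ.2]

/-- The restriction of a bi-infinite geodesic to nonnegative times, whose endpoint is `γ⁺`. -/
def ray (γ : UnitTangent H) : Ray H := ⟨fun t => γ.1 t, γ.2.comp isometry_subtype_coe⟩

theorem ray_zero (γ : UnitTangent H) : γ.ray.1 0 = γ.1 0 :=
  congrArg γ.1 NNReal.coe_zero

theorem mem_through_of_forward_eq (hCAT : IsCATNegOne H) {o x : H} {α γ : UnitTangent H}
    (hα : α ∈ through o x) (h0 : γ.1 0 = o) (hfwd : γ.forward = α.forward) : γ ∈ through o x := by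
  have hray : γ.ray = α.ray :=
    Ray.eq_of_endpoint_eq hCAT (by rw [ray_zero, ray_zero, h0, hα.1]) hfwd
  have hx : γ.1 (dist o x) = α.1 (dist o x) :=
    congrFun (congrArg Subtype.val hray) (nndist o x)
  exact ⟨h0, hx.trans hα.2⟩

theorem gromovProd_le_gromovProdBoundary_forward (hCAT : IsCATNegOne H) {o x y : H}
    {γ₁ γ₂ : UnitTangent H} (h₁ : γ₁ ∈ through o x) (h₂ : γ₂ ∈ through o y) :
    ((gromovProd o x y : ℝ) : EReal) ≤ gromovProdBoundary o γ₁.forward γ₂.forward := by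
  have h := Ray.gromovProd_le_gromovProdBoundary hCAT (c := γ₁.ray) (c' := γ₂.ray)
    (by rw [ray_zero, ray_zero, h₁.1, h₂.1]) (nndist o x) (nndist o y)
  rw [ray_zero, h₁.1] at h
  change ((gromovProd o (γ₁.1 (dist o x)) (γ₂.1 (dist o y)) : ℝ) : EReal) ≤ _ at h
  rwa [h₁.2, h₂.2] at h

theorem dist_le_of_le_gromovProdBoundary_forward (hCAT : IsCATNegOne H) {o : H}
    {γ₁ γ₂ : UnitTangent H} (h₁ : γ₁.1 0 = o) (h₂ : γ₂.1 0 = o) {G : ℝ}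
    (hG : (G : EReal) ≤ gromovProdBoundary o γ₁.forward γ₂.forward) {s : ℝ} (hs : 0 ≤ s) :
    dist (γ₁.1 s) (γ₂.1 s) ≤ 4 * exp ((s - G) / 2) := by
  lift s to ℝ≥0 using hs
  exact Ray.dist_le_four_mul_exp_half hCAT (c := γ₁.ray) (c' := γ₂.ray)
    (by rw [ray_zero, ray_zero, h₁, h₂]) (by rw [ray_zero, h₁]; exact hG) s

theorem dist_le_of_le_gromovProdBoundary_backward (hCAT : IsCATNegOne H) {o : H}
    {γ₁ γ₂ : UnitTangent H} (h₁ : γ₁.1 0 = o) (h₂ : γ₂.1 0 = o) {G : ℝ}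
    (hG : (G : EReal) ≤ gromovProdBoundary o γ₁.backward γ₂.backward) {s : ℝ} (hs : s ≤ 0) :
    dist (γ₁.1 s) (γ₂.1 s) ≤ 4 * exp ((-s - G) / 2) := by
  have hzero : ∀ {γ : UnitTangent H}, γ.1 0 = o → γ.reverse.1 0 = o := fun {γ} h =>
    (congrArg γ.1 neg_zero).trans h
  have h := dist_le_of_le_gromovProdBoundary_forward hCAT (hzero h₁) (hzero h₂) hG
    (neg_nonneg.2 hs)
  simpa only [reverse, neg_neg] using h

theorem sdist_flow_le {γ₁ γ₂ : UnitTangent H} {R₁ R₂ T t : ℝ} (hR₁ : 0 < R₁) (hR₂ : 0 < R₂)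
    (ht0 : 0 ≤ t) (htT : t ≤ T)
    (hfwd : ∀ s, 0 ≤ s → dist (γ₁.1 s) (γ₂.1 s) ≤ 4 * exp ((s - T) / 2))
    (hbwd : ∀ s, s ≤ 0 → dist (γ₁.1 s) (γ₂.1 s) ≤ 4 * exp ((-s - (R₁ * T - R₂)) / 2)) :
    sdist (flow t γ₁) (flow t γ₂) ≤ 8 * exp (R₂ / 2) * exp (-(min 1 R₁ / 2 * (T - t))) := by
  have hc0 : 0 < min 1 R₁ / 2 := by positivity
  have hc₁ : min 1 R₁ / 2 ≤ 1 / 2 := by linarith [min_le_left 1 R₁]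
  have hc₂ : min 1 R₁ / 2 ≤ R₁ / 2 := by linarith [min_le_right 1 R₁]
  generalize min 1 R₁ / 2 = c at *
  have hsdist : sdist (flow t γ₁) (flow t γ₂) ≤ 2 * (4 * exp (R₂ / 2 - c * (T - t))) := by
    refine sdist_le fun s => ?_
    rw [mul_assoc, ← exp_add]
    change dist (γ₁.1 (t + s)) (γ₂.1 (t + s)) ≤ _
    rcases le_total 0 (t + s) with hs | hs
    · refine (hfwd _ hs).trans ?_
      gcongr
      nlinarith [le_abs_self s]
    · refine (hbwd _ hs).trans ?_
      gcongr
      nlinarith [neg_le_abs s]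
  rw [sub_eq_add_neg, exp_add] at hsdist
  linarith

end UnitTangent

theorem BoundedFlip.exists_sdist_flow_le (hflip : BoundedFlip H) (hCAT : IsCATNegOne H)
    (hcomplete : GeodesicallyComplete H) :
    ∃ c A : ℝ, 0 < c ∧ 0 ≤ A ∧ ∀ o x y : H, o ≠ x → o ≠ y →
      ∃ γ₁ ∈ through o x, ∃ γ₂ ∈ through o y, ∀ t ∈ Set.Icc 0 (gromovProd o x y),
        sdist (flow t γ₁) (flow t γ₂) ≤ A * exp (-(c * (gromovProd o x y - t))) := by
  obtain ⟨R₁, R₂, hR₁, hR₂, hR⟩ := hflip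
  refine ⟨min 1 R₁ / 2, 8 * exp (R₂ / 2), by positivity, by positivity, fun o x y hox hoy => ?_⟩
  obtain ⟨α₁, hα₁⟩ := hcomplete o x hox
  obtain ⟨α₂, hα₂⟩ := hcomplete o y hoy
  obtain ⟨γ₁, γ₂, hfwd₁, hfwd₂, h₁, h₂, hbwd⟩ := hR α₁.forward α₂.forward o
  have hγ₁ := mem_through_of_forward_eq hCAT hα₁ h₁ hfwd₁
  have hγ₂ := mem_through_of_forward_eq hCAT hα₂ h₂ hfwd₂
  have hT := gromovProd_le_gromovProdBoundary_forward hCAT hγ₁ hγ₂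
  have hflipped : ((R₁ * gromovProd o x y - R₂ : ℝ) : EReal) ≤
      gromovProdBoundary o γ₁.backward γ₂.backward := by
    rw [EReal.coe_sub, EReal.coe_mul]
    exact (EReal.sub_le_sub
      (mul_le_mul_of_nonneg_left hT (EReal.coe_nonneg.2 hR₁.le)) le_rfl).trans hbwd
  exact ⟨γ₁, hγ₁, γ₂, hγ₂, fun t ht => sdist_flow_le hR₁ hR₂ ht.1 ht.2
    (fun _ => dist_le_of_le_gromovProdBoundary_forward hCAT h₁ h₂ hT)
    (fun _ => dist_le_of_le_gromovProdBoundary_backward hCAT h₁ h₂ hflipped)⟩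

namespace IsTemperedHolder

variable {Φ : UnitTangent H → ℝ}

theorem continuous_flow (hΦ : IsTemperedHolder Φ) (γ : UnitTangent H) :
    Continuous fun t => Φ (flow t γ) := by
  obtain ⟨K, β, hβ, -, hK⟩ := hΦ.holder
  refine continuous_iff_continuousAt.2 fun s => tendsto_iff_dist_tendsto_zero.2 ?_
  have hmodulus : Tendsto (fun t => |K| * (2 * |t - s|) ^ β) (𝓝 s) (𝓝 0) := by
    have hlin : Tendsto (fun t => 2 * |t - s|) (𝓝 s) (𝓝 0) :=
      Continuous.tendsto' (by fun_prop) _ _ (by rw [sub_self, abs_zero, mul_zero])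
    simpa only [Real.zero_rpow hβ.ne', mul_zero] using
      (hlin.rpow_const (Or.inr hβ.le)).const_mul |K|
  refine squeeze_zero (fun _ => dist_nonneg) (fun t => ?_) hmodulus
  calc dist (Φ (flow t γ)) (Φ (flow s γ)) ≤ K * sdist (flow t γ) (flow s γ) ^ β := hK _ _
    _ ≤ |K| * (2 * |t - s|) ^ β := by
      gcongr
      · exact rpow_nonneg (sdist_nonneg _ _) _
      · exact le_abs_self K
      · exact sdist_nonneg _ _
      · exact sdist_flow_flow_le γ t s

theorem intervalIntegrable (hΦ : IsTemperedHolder Φ) (γ : UnitTangent H) (a b : ℝ) :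
    IntervalIntegrable (fun t => Φ (flow t γ)) volume a b :=
  (hΦ.continuous_flow γ).intervalIntegrable a b

theorem comp_reverse (hΦ : IsTemperedHolder Φ) : IsTemperedHolder (Φ ∘ reverse) where
  bounded := hΦ.bounded.imp fun _ hL γ => hL (reverse γ)
  holder := by
    obtain ⟨K, β, hβ, hβ1, hK⟩ := hΦ.holder
    exact ⟨K, β, hβ, hβ1, fun γ₁ γ₂ => sdist_reverse γ₁ γ₂ ▸ hK (reverse γ₁) (reverse γ₂)⟩
  tempered p q hpq γ₁ h₁ γ₂ h₂ t ht := by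
    have h := hΦ.tempered q p hpq.symm _ (reverse_flow_mem_through h₁) _
      (reverse_flow_mem_through h₂) (dist p q - t)
      ⟨sub_nonneg.2 ht.2, by linarith [ht.1, dist_comm p q]⟩
    simpa only [flow_reverse_flow, sub_sub_cancel, Function.comp_apply] using h

theorem phiDist_eq (hΦ : IsTemperedHolder Φ) {p q : H} {γ : UnitTangent H}
    (hγ : γ ∈ through p q) : phiDist Φ p q = ∫ t in (0 : ℝ)..dist p q, Φ (flow t γ) := by
  have hne : (through p q).Nonempty := ⟨γ, hγ⟩
  rw [phiDist, dif_pos hne]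
  rcases eq_or_ne p q with rfl | hpq
  · simp only [dist_self, intervalIntegral.integral_same]
  · refine intervalIntegral.integral_congr fun t ht => ?_
    rw [Set.uIcc_of_le dist_nonneg] at ht
    exact hΦ.tempered p q hpq _ hne.choose_spec _ hγ t ht

theorem phiDist_comp_reverse (hΦ : IsTemperedHolder Φ) (p q : H) :
    phiDist (Φ ∘ reverse) p q = phiDist Φ q p := by
  by_cases hne : (through p q).Nonempty
  · obtain ⟨γ, hγ⟩ := hne
    have hrev := reverse_flow_mem_through hγ
    rw [hΦ.comp_reverse.phiDist_eq hγ, hΦ.phiDist_eq hrev, dist_comm q p]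
    simp only [flow_reverse_flow, Function.comp_apply]
    rw [intervalIntegral.integral_comp_sub_left (fun t => Φ (reverse (flow t γ))), sub_self,
      sub_zero]
  · have hne' : ¬(through q p).Nonempty := fun ⟨γ, hγ⟩ => hne ⟨_, reverse_flow_mem_through hγ⟩
    rw [phiDist, dif_neg hne, phiDist, dif_neg hne']

end IsTemperedHolder

theorem phiDist_self (Φ : UnitTangent H → ℝ) (p : H) : phiDist Φ p p = 0 := by
  simp only [phiDist, dist_self, intervalIntegral.integral_same, dite_eq_ite, ite_self]

theorem abs_phiDist_le {Φ : UnitTangent H → ℝ} {L : ℝ} (hL : ∀ γ, |Φ γ| ≤ L) (p q : H) :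
    |phiDist Φ p q| ≤ |L| * dist p q := by
  rw [phiDist]
  split_ifs with h
  · have hint := intervalIntegral.norm_integral_le_of_norm_le_const (a := 0) (b := dist p q)
      (f := fun t => Φ (flow t h.choose)) fun t _ => (hL _).trans (le_abs_self L)
    rwa [sub_zero, abs_of_nonneg dist_nonneg] at hint
  · rw [abs_zero]
    positivity

theorem IsTemperedHolder.phiDist_add {Φ : UnitTangent H → ℝ} (hΦ : IsTemperedHolder Φ)
    (hCAT : IsCATNegOne H) (hcomplete : GeodesicallyComplete H) {p m q : H}
    (hm : dist p m + dist m q = dist p q) : phiDist Φ p q = phiDist Φ p m + phiDist Φ m q := by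
  rcases eq_or_ne p q with rfl | hpq
  · obtain rfl : p = m := dist_le_zero.1 (by
      linarith [dist_self p, dist_nonneg (x := m) (y := p)])
    rw [phiDist_self, add_zero]
  · obtain ⟨γ, hγ⟩ := hcomplete p q hpq
    rw [hΦ.phiDist_eq hγ, hΦ.phiDist_eq (mem_through_left hCAT hγ hm),
      hΦ.phiDist_eq (flow_mem_through_right hCAT hγ hm)]
    simp only [flow_flow]
    rw [intervalIntegral.integral_comp_add_left (fun t => Φ (flow t γ)), add_zero, hm,
      intervalIntegral.integral_add_adjacent_intervals (hΦ.intervalIntegrable _ _ _)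
        (hΦ.intervalIntegrable _ _ _)]

theorem IsTemperedHolder.exists_abs_flow_sub_le {Φ : UnitTangent H → ℝ} (hΦ : IsTemperedHolder Φ)
    (hflip : BoundedFlip H) (hCAT : IsCATNegOne H) (hcomplete : GeodesicallyComplete H) :
    ∃ ε C : ℝ, 0 < ε ∧ 0 ≤ C ∧ ∀ o x y : H, o ≠ x → o ≠ y →
      ∃ γ₁ ∈ through o x, ∃ γ₂ ∈ through o y, ∀ t ∈ Set.Icc 0 (gromovProd o x y),
        |Φ (flow t γ₁) - Φ (flow t γ₂)| ≤ C * exp (-(ε * (gromovProd o x y - t))) := by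
  obtain ⟨c, A, hc, hA, hflow⟩ := hflip.exists_sdist_flow_le hCAT hcomplete
  obtain ⟨K, β, hβ, -, hK⟩ := hΦ.holder
  refine ⟨c * β, |K| * A ^ β, by positivity, by positivity, fun o x y hox hoy => ?_⟩
  obtain ⟨γ₁, h₁, γ₂, h₂, hγ⟩ := hflow o x y hox hoy
  refine ⟨γ₁, h₁, γ₂, h₂, fun t ht => ?_⟩
  calc |Φ (flow t γ₁) - Φ (flow t γ₂)| ≤ K * sdist (flow t γ₁) (flow t γ₂) ^ β := hK _ _
    _ ≤ |K| * (A * exp (-(c * (gromovProd o x y - t)))) ^ β := by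
      gcongr
      · exact rpow_nonneg (sdist_nonneg _ _) _
      · exact le_abs_self K
      · exact sdist_nonneg _ _
      · exact hγ t ht
    _ = |K| * A ^ β * exp (-(c * β * (gromovProd o x y - t))) := by
      rw [mul_rpow hA (exp_pos _).le, ← exp_mul]
      ring_nf

theorem integral_exp_neg_mul_sub_le {ε : ℝ} (hε : 0 < ε) (T τ : ℝ) :
    ∫ t in (0 : ℝ)..τ, exp (-(ε * (T - t))) ≤ exp (-(ε * (T - τ))) / ε := by
  have hprim : ∀ t ∈ Set.uIcc 0 τ,
      HasDerivAt (fun t => exp (-(ε * (T - t))) / ε) (exp (-(ε * (T - t)))) t := fun t _ => by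
    have h := ((((hasDerivAt_id t).const_sub T).const_mul ε).neg.exp).div_const ε
    rwa [mul_neg_one, neg_neg, mul_div_cancel_right₀ _ hε.ne'] at h
  rw [intervalIntegral.integral_eq_sub_of_hasDerivAt hprim
    (Continuous.intervalIntegrable (by fun_prop) _ _)]
  exact sub_le_self _ (by positivity)

theorem IsTemperedHolder.exists_abs_phiDist_sub_le {Φ : UnitTangent H → ℝ}
    (hΦ : IsTemperedHolder Φ) (hflip : BoundedFlip H) (hCAT : IsCATNegOne H)
    (hcomplete : GeodesicallyComplete H) :
    ∃ ε C : ℝ, 0 < ε ∧ 0 ≤ C ∧ ∀ o x y u v : H, dist o u + dist u x = dist o x →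
      dist o v + dist v y = dist o y → dist o u = dist o v → dist o u ≤ gromovProd o x y →
      |phiDist Φ o u - phiDist Φ o v| ≤ C * exp (-(ε * (gromovProd o x y - dist o u))) := by
  obtain ⟨ε, C, hε, hC, hflow⟩ := hΦ.exists_abs_flow_sub_le hflip hCAT hcomplete
  refine ⟨ε, C / ε, hε, by positivity, fun o x y u v hu hv huv huT => ?_⟩
  rcases (dist_nonneg (x := o) (y := u)).eq_or_lt with hou | hou
  · rw [← dist_eq_zero.1 hou.symm, ← dist_eq_zero.1 (huv.symm.trans hou.symm), sub_self, abs_zero]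
    positivity
  have hox : o ≠ x := dist_pos.1 (by linarith [dist_nonneg (x := u) (y := x)])
  have hoy : o ≠ y := dist_pos.1 (by linarith [dist_nonneg (x := v) (y := y)])
  obtain ⟨γ₁, h₁, γ₂, h₂, hγ⟩ := hflow o x y hox hoy
  set T := gromovProd o x y
  rw [hΦ.phiDist_eq (mem_through_left hCAT h₁ hu), hΦ.phiDist_eq (mem_through_left hCAT h₂ hv),
    ← huv, ← intervalIntegral.integral_sub (hΦ.intervalIntegrable _ _ _)
      (hΦ.intervalIntegrable _ _ _)]
  calc |∫ t in (0 : ℝ)..dist o u, (Φ (flow t γ₁) - Φ (flow t γ₂))|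
      ≤ ∫ t in (0 : ℝ)..dist o u, C * exp (-(ε * (T - t))) :=
        intervalIntegral.norm_integral_le_of_norm_le
          (f := fun t => Φ (flow t γ₁) - Φ (flow t γ₂)) dist_nonneg
          (ae_of_all _ fun t ht => hγ t ⟨ht.1.le, ht.2.trans huT⟩)
          (Continuous.intervalIntegrable (by fun_prop) _ _)
    _ = C * ∫ t in (0 : ℝ)..dist o u, exp (-(ε * (T - t))) :=
        intervalIntegral.integral_const_mul _ _
    _ ≤ C * (exp (-(ε * (T - dist o u))) / ε) :=
        mul_le_mul_of_nonneg_left (integral_exp_neg_mul_sub_le hε T (dist o u)) hC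
    _ = C / ε * exp (-(ε * (T - dist o u))) := by ring

/-! ### The four-point estimate -/

/-- The properties of `f = d^Φ` from which the four-point estimate follows. Points `u` of `[o, x]`
and `v` of `[o, y]` at the same distance `t ≤ (x · y)_o` from `o` lie on fellow-travelling pieces
of the two segments, and the values of `f` on `[o, u]` and `[o, v]`, in either direction, differ by
at most `C * exp (-ε * ((x · y)_o - t))`. -/
structure IsHyperbolicPotential (f : H → H → ℝ) (ε C L : ℝ) : Prop where
  eps_pos : 0 < ε
  eps_le_one : ε ≤ 1
  C_nonneg : 0 ≤ C
  L_nonneg : 0 ≤ L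
  add : ∀ {p m q : H}, dist p m + dist m q = dist p q → f p q = f p m + f m q
  abs_le_mul_dist : ∀ p q : H, |f p q| ≤ L * dist p q
  abs_sub_le_of_source : ∀ {o x y u v : H}, dist o u + dist u x = dist o x →
    dist o v + dist v y = dist o y → dist o u = dist o v → dist o u ≤ gromovProd o x y →
    |f o u - f o v| ≤ C * exp (-(ε * (gromovProd o x y - dist o u)))
  abs_sub_le_of_target : ∀ {o x y u v : H}, dist o u + dist u x = dist o x →
    dist o v + dist v y = dist o y → dist o u = dist o v → dist o u ≤ gromovProd o x y →
    |f u o - f v o| ≤ C * exp (-(ε * (gromovProd o x y - dist o u)))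

theorem IsTemperedHolder.exists_isHyperbolicPotential {Φ : UnitTangent H → ℝ}
    (hΦ : IsTemperedHolder Φ) (hflip : BoundedFlip H) (hCAT : IsCATNegOne H)
    (hcomplete : GeodesicallyComplete H) :
    ∃ ε C L : ℝ, IsHyperbolicPotential (phiDist Φ) ε C L := by
  obtain ⟨ε₁, C₁, hε₁, hC₁, h₁⟩ := hΦ.exists_abs_phiDist_sub_le hflip hCAT hcomplete
  obtain ⟨ε₂, C₂, hε₂, -, h₂⟩ := hΦ.comp_reverse.exists_abs_phiDist_sub_le hflip hCAT hcomplete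
  obtain ⟨L, hL⟩ := hΦ.bounded
  have hweaken : ∀ {ε' C' s a : ℝ}, C' ≤ max C₁ C₂ → min (min ε₁ ε₂) 1 ≤ ε' → 0 ≤ s →
      a ≤ C' * exp (-(ε' * s)) → a ≤ max C₁ C₂ * exp (-(min (min ε₁ ε₂) 1 * s)) :=
    fun hC hε hs ha => ha.trans (by gcongr)
  refine ⟨min (min ε₁ ε₂) 1, max C₁ C₂, |L|, by positivity, min_le_right _ _,
    hC₁.trans (le_max_left _ _), abs_nonneg L, hΦ.phiDist_add hCAT hcomplete, abs_phiDist_le hL,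
    fun hu hv huv huT => hweaken (le_max_left _ _) ((min_le_left _ _).trans (min_le_left _ _))
      (sub_nonneg.2 huT) (h₁ _ _ _ _ _ hu hv huv huT), fun {o x y u v} hu hv huv huT => ?_⟩
  rw [← hΦ.phiDist_comp_reverse, ← hΦ.phiDist_comp_reverse]
  exact hweaken (le_max_right _ _) ((min_le_left _ _).trans (min_le_right _ _))
    (sub_nonneg.2 huT) (h₂ _ _ _ _ _ hu hv huv huT)

namespace IsHyperbolicPotential

variable {f : H → H → ℝ} {ε C L : ℝ}

theorem abs_sub_le_dist (hf : IsHyperbolicPotential f ε C L) (hCAT : IsCATNegOne H) (p q z : H) :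
    |f q z - f p z| ≤ C + L * dist p q := by
  set T := gromovProd z p q with hT
  obtain ⟨u, hzu, hu⟩ := hCAT.exists_point z p (gromovProd_nonneg z p q) (gromovProd_le_left z p q)
  obtain ⟨v, hzv, hv⟩ := hCAT.exists_point z q (gromovProd_nonneg z p q) (gromovProd_le_right z p q)
  have hcommon := hf.abs_sub_le_of_target hu hv (hzu.trans hzv.symm) hzu.le
  rw [hzu, sub_self, mul_zero, neg_zero, exp_zero, mul_one] at hcommon
  have hlegs : L * dist p u + L * dist q v = L * dist p q := by
    rw [← mul_add]
    congr 1
    rw [gromovProd, dist_comm p z, dist_comm q z] at hT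
    linarith [dist_comm u p, dist_comm v q]
  have hp := abs_le.1 (hf.abs_le_mul_dist p u)
  have hq := abs_le.1 (hf.abs_le_mul_dist q v)
  have huv := abs_le.1 hcommon
  rw [hf.add (dist_add_dist_eq_symm hu), hf.add (dist_add_dist_eq_symm hv), abs_le]
  constructor <;> linarith [hp.1, hp.2, hq.1, hq.2, huv.1, huv.2]

theorem exists_abs_sub_sub_sub_le (hf : IsHyperbolicPotential f ε C L) (hCAT : IsCATNegOne H)
    {p q w m : H} {s : ℝ} (hm : dist p m + dist m w = dist p w) (hs : 0 ≤ s)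
    (hsm : dist p q + s ≤ dist p m) :
    ∃ n, dist q n + dist n w = dist q w ∧ dist n w = dist m w ∧
      |(f q w - f p w) - (f q n - f p m)| ≤ C * exp (-(ε * s)) := by
  have hgap : s ≤ gromovProd w p q - dist w m := by
    have hpq := gromovProd_add_gromovProd w p q
    have hpw := gromovProd_add_gromovProd p w q
    rw [gromovProd_comm p w q] at hpw
    linarith [hpq, gromovProd_le_left p q w, dist_comm w m]
  have hmT : dist w m ≤ gromovProd w p q := by linarith
  obtain ⟨n, hwn, hn⟩ := hCAT.exists_point w q dist_nonneg (hmT.trans (gromovProd_le_right w p q))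
  have hn' := dist_add_dist_eq_symm hn
  refine ⟨n, hn', by rw [dist_comm n, hwn, dist_comm], ?_⟩
  calc |(f q w - f p w) - (f q n - f p m)| = |f m w - f n w| := by
        rw [hf.add hm, hf.add hn', abs_sub_comm]
        congr 1
        ring
    _ ≤ C * exp (-(ε * (gromovProd w p q - dist w m))) :=
        hf.abs_sub_le_of_target (dist_add_dist_eq_symm hm) hn hwn.symm hmT
    _ ≤ C * exp (-(ε * s)) := by
        have := hf.C_nonneg
        have := hf.eps_pos.le
        gcongr

theorem abs_sub_le_add (hf : IsHyperbolicPotential f ε C L) (hCAT : IsCATNegOne H)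
    {o x y u v : H} {s : ℝ} (hu : dist o u + dist u x = dist o x)
    (hv : dist o v + dist v y = dist o y) (hs : 0 ≤ s)
    (hsT : (dist o u + dist o v) / 2 + s ≤ gromovProd o x y) :
    |f o u - f o v| ≤ C * exp (-(ε * s)) + L * |dist o u - dist o v| := by
  wlog huv : dist o u ≤ dist o v generalizing x y u v
  · rw [abs_sub_comm, abs_sub_comm (dist o u)]
    exact this hv hu (by rwa [gromovProd_comm, add_comm (dist o v)]) (le_of_not_ge huv)
  obtain ⟨v', hov', hv'⟩ := hCAT.exists_point o v dist_nonneg huv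
  have hv'y : dist o v' + dist v' y = dist o y :=
    le_antisymm (by linarith [dist_triangle v' v y]) (dist_triangle o v' y)
  have hsource : |f o u - f o v'| ≤ C * exp (-(ε * s)) := by
    have := hf.C_nonneg
    have := hf.eps_pos.le
    refine (hf.abs_sub_le_of_source hu hv'y hov'.symm (by linarith)).trans ?_
    gcongr
    linarith
  calc |f o u - f o v| = |(f o u - f o v') - f v' v| := by rw [hf.add hv', sub_sub]
    _ ≤ C * exp (-(ε * s)) + L * dist v' v :=
        (abs_sub _ _).trans (add_le_add hsource (hf.abs_le_mul_dist v' v))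
    _ = C * exp (-(ε * s)) + L * |dist o u - dist o v| := by
        rw [abs_sub_comm, abs_of_nonneg (sub_nonneg.2 huv), ← hv', hov', add_sub_cancel_left]

theorem abs_quadrilateral_le (hf : IsHyperbolicPotential f ε C L) (hCAT : IsCATNegOne H)
    {p q z z' : H} {s : ℝ} (hs : 0 ≤ s) (hsT : dist p q + 2 * s ≤ gromovProd p z z') :
    |(f q z - f p z) - (f q z' - f p z')| ≤ (4 * C + 2 * L) * exp (-(ε * s)) := by
  have hd : 0 ≤ dist p q := dist_nonneg
  obtain ⟨m, hpm, hm⟩ := hCAT.exists_point p z (t := dist p q + s) (by linarith)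
    (by linarith [gromovProd_le_left p z z'])
  obtain ⟨m', hpm', hm'⟩ := hCAT.exists_point p z' (t := dist p q + s) (by linarith)
    (by linarith [gromovProd_le_right p z z'])
  obtain ⟨n, hn, hnz, htail⟩ := hf.exists_abs_sub_sub_sub_le hCAT hm hs hpm.ge
  obtain ⟨n', hn', hnz', htail'⟩ := hf.exists_abs_sub_sub_sub_le hCAT hm' hs hpm'.ge
  have hhead : |f p m - f p m'| ≤ C * exp (-(ε * s)) := by
    have h := hf.abs_sub_le_add hCAT hm hm' hs (by linarith)
    rwa [hpm, hpm', sub_self, abs_zero, mul_zero, add_zero] at h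
  have hqn : |dist q n - dist q n'| ≤ 2 * exp (-(ε * s)) :=
    calc |dist q n - dist q n'| = |(dist p z - dist q z) - (dist p z' - dist q z')| := by
          rw [← abs_neg]
          congr 1
          linarith
      _ ≤ 2 * exp (-(gromovProd p z z' - dist p q) / 2) := hCAT.abs_dist_quadrilateral_le
          (gromovProd_le_left p q z) (gromovProd_le_left p q z') (by linarith)
      _ ≤ 2 * exp (-(ε * s)) := by
          gcongr
          nlinarith [hf.eps_le_one]
  have hhead' : |f q n - f q n'| ≤ C * exp (-(ε * s)) + L * (2 * exp (-(ε * s))) := by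
    refine (hf.abs_sub_le_add hCAT hn hn' hs ?_).trans
      (add_le_add_right (mul_le_mul_of_nonneg_left hqn hf.L_nonneg) _)
    simp only [gromovProd, dist_comm z p, dist_comm z' p, dist_comm z q, dist_comm z' q] at hsT ⊢
    linarith
  calc |(f q z - f p z) - (f q z' - f p z')|
      = |((f q z - f p z) - (f q n - f p m)) - ((f q z' - f p z') - (f q n' - f p m')) +
          ((f q n - f q n') - (f p m - f p m'))| := by
        congr 1
        ring
    _ ≤ C * exp (-(ε * s)) + C * exp (-(ε * s)) +
          (C * exp (-(ε * s)) + L * (2 * exp (-(ε * s))) + C * exp (-(ε * s))) :=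
        (abs_add_le _ _).trans (add_le_add ((abs_sub _ _).trans (add_le_add htail htail'))
          ((abs_sub _ _).trans (add_le_add hhead' hhead)))
    _ = (4 * C + 2 * L) * exp (-(ε * s)) := by ring

theorem abs_quadrilateral_le_of_sub_one_lt (hf : IsHyperbolicPotential f ε C L)
    (hCAT : IsCATNegOne H) {p q z z' : H} (hT : dist p q - 1 < gromovProd p z z') :
    |(f q z - f p z) - (f q z' - f p z')| ≤
      (6 * C + 4 * L) * exp (-(ε / 2 * (gromovProd p z z' - dist p q))) := by
  have hC := hf.C_nonneg
  have hL := hf.L_nonneg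
  rcases le_or_gt (dist p q) (gromovProd p z z') with hdT | hdT
  · refine (hf.abs_quadrilateral_le hCAT (s := (gromovProd p z z' - dist p q) / 2) (by linarith)
      (by linarith)).trans ?_
    rw [mul_comm_div]
    gcongr <;> norm_num
  obtain ⟨r, hpr, hr⟩ := hCAT.exists_point p q (gromovProd_nonneg p z z') hdT.le
  have hrq : L * dist r q ≤ L * 1 := mul_le_mul_of_nonneg_left (by linarith) hL
  have hnear := hf.abs_quadrilateral_le hCAT (q := r) (z := z) (z' := z') le_rfl (by linarith)
  rw [mul_zero, neg_zero, exp_zero, mul_one] at hnear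
  calc |(f q z - f p z) - (f q z' - f p z')|
      = |(f r z - f p z) - (f r z' - f p z') + ((f q z - f r z) - (f q z' - f r z'))| := by
        congr 1
        ring
    _ ≤ 4 * C + 2 * L + (C + L * 1 + (C + L * 1)) := by
        refine (abs_add_le _ _).trans (add_le_add hnear ((abs_sub _ _).trans (add_le_add ?_ ?_)))
        · exact (hf.abs_sub_le_dist hCAT r q z).trans (by gcongr)
        · exact (hf.abs_sub_le_dist hCAT r q z').trans (by gcongr)
    _ = (6 * C + 4 * L) * 1 := by ring
    _ ≤ (6 * C + 4 * L) * exp (-(ε / 2 * (gromovProd p z z' - dist p q))) := by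
        gcongr
        exact one_le_exp (by nlinarith [hf.eps_pos])

end IsHyperbolicPotential

namespace IsHyperbolicPotential

variable {f : H → H → ℝ} {ε C L : ℝ}

theorem exists_tendsto_sub (hf : IsHyperbolicPotential f ε C L) (hCAT : IsCATNegOne H)
    (ξ : Boundary H) (p q : H) :
    ∃ a, Tendsto (fun z => f q z - f p z) (nhdsBoundary ξ) (𝓝 a) := by
  have hprod := tendsto_gromovProd_self p ξ
  have herror : Tendsto (fun T => (6 * C + 4 * L) * exp (-(ε / 2 * (T - dist p q)))) atTop
      (𝓝 0) := by
    have hexponent : Tendsto (fun T => -(ε / 2 * (T - dist p q))) atTop atBot :=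
      tendsto_neg_atTop_atBot.comp
        ((tendsto_atTop_add_const_right _ _ tendsto_id).const_mul_atTop (half_pos hf.eps_pos))
    simpa only [mul_zero, Function.comp_def] using
      (tendsto_exp_atBot.comp hexponent).const_mul (6 * C + 4 * L)
  have := nhdsBoundary_neBot hCAT ξ
  exact exists_tendsto_of_eventually_dist_le (herror.comp hprod)
    ((hprod.eventually_gt_atTop (dist p q - 1)).mono fun _ hz =>
      hf.abs_quadrilateral_le_of_sub_one_lt hCAT hz)

theorem abs_sub_le_of_tendsto (hf : IsHyperbolicPotential f ε C L) (hCAT : IsCATNegOne H)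
    {ζ ν : Boundary H} {p q : H} {a b T : ℝ}
    (ha : Tendsto (fun z => f q z - f p z) (nhdsBoundary ζ) (𝓝 a))
    (hb : Tendsto (fun z => f q z - f p z) (nhdsBoundary ν) (𝓝 b))
    (hT : Tendsto (fun z : H × H => gromovProd p z.1 z.2) (nhdsBoundary ζ ×ˢ nhdsBoundary ν)
      (𝓝 T)) (hdT : dist p q ≤ T) :
    |a - b| ≤ (6 * C + 4 * L) * exp (-(ε / 2 * (T - dist p q))) := by
  have := nhdsBoundary_neBot hCAT ζ
  have := nhdsBoundary_neBot hCAT ν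
  have hdiff := (ha.comp (tendsto_fst (g := nhdsBoundary ν))).sub
    (hb.comp (tendsto_snd (f := nhdsBoundary ζ)))
  have herror : Continuous fun T => (6 * C + 4 * L) * exp (-(ε / 2 * (T - dist p q))) := by
    fun_prop
  refine le_of_tendsto_of_tendsto hdiff.abs ((herror.tendsto T).comp hT) ?_
  filter_upwards [hT.eventually_const_lt (by linarith : dist p q - 1 < T)] with z hz
  exact hf.abs_quadrilateral_le_of_sub_one_lt hCAT hz

end IsHyperbolicPotential

theorem BoundedFlip.exists_tendsto_gromovProd (hflip : BoundedFlip H) (hCAT : IsCATNegOne H)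
    (p : H) {ζ ν : Boundary H} (hne : ζ ≠ ν) :
    ∃ T, Tendsto (fun z : H × H => gromovProd p z.1 z.2) (nhdsBoundary ζ ×ˢ nhdsBoundary ν)
      (𝓝 T) := by
  obtain ⟨R₁, R₂, -, -, hR⟩ := hflip
  obtain ⟨γ₁, γ₂, rfl, rfl, h₁, h₂, -⟩ := hR ζ ν p
  have h := Ray.exists_tendsto_gromovProd hCAT (c := γ₁.ray) (c' := γ₂.ray)
    (by rw [ray_zero, ray_zero, h₁, h₂]) hne
  rwa [ray_zero, h₁] at h

theorem IsHyperbolicPotential.tendsto_phiBusemann {Φ : UnitTangent H → ℝ} {ε C L : ℝ}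
    (hf : IsHyperbolicPotential (phiDist Φ) ε C L) (hCAT : IsCATNegOne H) (ξ : Boundary H)
    (p q : H) :
    Tendsto (fun z => phiDist Φ q z - phiDist Φ p z) (nhdsBoundary ξ) (𝓝 (phiBusemann Φ ξ p q)) :=
  tendsto_nhds_limUnder (hf.exists_tendsto_sub hCAT ξ p q)

theorem IsHyperbolicPotential.abs_phiBusemann_sub_div_le {Φ : UnitTangent H → ℝ} {ε C L : ℝ}
    (hf : IsHyperbolicPotential (phiDist Φ) ε C L) (hflip : BoundedFlip H)
    (hCAT : IsCATNegOne H) {ζ ν : Boundary H} {p q : H} (hne : ζ ≠ ν)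
    (hvis : visualDist p ζ ν ≤ exp (-dist p q)) :
    |phiBusemann Φ ζ p q - phiBusemann Φ ν p q| / visualDist p ζ ν ^ (ε / 2) ≤
      (6 * C + 4 * L) * exp (ε / 2 * dist p q) := by
  obtain ⟨T, hT⟩ := hflip.exists_tendsto_gromovProd hCAT p hne
  rw [visualDist_eq hCAT hT] at hvis ⊢
  have hdT : dist p q ≤ T := neg_le_neg_iff.1 (exp_le_exp.1 hvis)
  rw [div_le_iff₀ (rpow_pos_of_pos (exp_pos _) _), mul_assoc, ← exp_mul, ← exp_add]
  refine (hf.abs_sub_le_of_tendsto hCAT (hf.tendsto_phiBusemann hCAT ζ p q)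
    (hf.tendsto_phiBusemann hCAT ν p q) hT hdT).trans_eq ?_
  ring_nf

end NegCurv

end

theorem mainTheorem5 {H : Type*} [MetricSpace H]
    (hCAT : NegCurv.IsCATNegOne H) (hcomplete : NegCurv.GeodesicallyComplete H)
    (hflip : NegCurv.BoundedFlip H)
    (Φ : NegCurv.UnitTangent H → ℝ) (hΦ : NegCurv.IsTemperedHolder Φ) :
    (∀ (ξ : NegCurv.Boundary H) (p q : H),
      Tendsto (fun z => NegCurv.phiDist Φ q z - NegCurv.phiDist Φ p z)
        (NegCurv.nhdsBoundary ξ) (𝓝 (NegCurv.phiBusemann Φ ξ p q))) ∧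
    ∃ ε : ℝ, 0 < ε ∧ ∃ D : ℝ, ∀ p q : H,
      (⨆ (ζ : NegCurv.Boundary H) (ν : NegCurv.Boundary H)
          (_ : ζ ≠ ν) (_ : NegCurv.visualDist p ζ ν ≤ Real.exp (-dist p q)),
        ENNReal.ofReal
          (|NegCurv.phiBusemann Φ ζ p q - NegCurv.phiBusemann Φ ν p q|
            / NegCurv.visualDist p ζ ν ^ ε))
      < ENNReal.ofReal (D * Real.exp (ε * dist p q)) := by
  obtain ⟨ε, C, L, h⟩ := hΦ.exists_isHyperbolicPotential hflip hCAT hcomplete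
  have hC := h.C_nonneg
  have hL := h.L_nonneg
  refine ⟨h.tendsto_phiBusemann hCAT, ε / 2, half_pos h.eps_pos, 6 * C + 4 * L + 1,
    fun p q => ?_⟩
  refine lt_of_le_of_lt (b := ENNReal.ofReal ((6 * C + 4 * L) * Real.exp (ε / 2 * dist p q)))
    (iSup_le fun ζ => iSup_le fun ν => iSup_le fun hne => iSup_le fun hvis => ?_) ?_
  · exact ENNReal.ofReal_le_ofReal (h.abs_phiBusemann_sub_div_le hflip hCAT hne hvis)
  · exact (ENNReal.ofReal_lt_ofReal_iff (by positivity)).2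
      (mul_lt_mul_of_pos_right (lt_add_one _) (Real.exp_pos _))
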